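/- Let $p$ be a prime, let $P$ be a group of order $p^m$, and let $T$ be a free $\mathbb{Z}_p$-module of finite rank on which $P$ acts $\mathbb{Z}_p$-linearly. Let $r_0 \ge 3m$ and put $M_r = T/p^{r+1}T$ for $r \ge r_0$. All cochains are normalized, with coboundary $\Delta$. For a group $G$, a sequence $\alpha_\bullet=(\alpha_r)_{r\ge r_0}$ with $\alpha_r \in C^n(G,M_r)$ is called a *cochain sequence of level at most $k$* if there are an integer $0 \le \omega \le \min(k,r_0)$, a cochain $\rho \in C^n(G,T)$ and a cochain $\sigma \in C^n(G,pT)$ such that $\alpha_r$ is the reduction of $\rho + p^{r-\omega}\sigma$ modulo $p^{r+1}T$ for all $r \ge r_0$. Let $\tau_\bullet$ be a cochain sequence of level at most $m$ with $\tau_r \in Z^2(P,M_r)$ for all $r \ge r_0$. Let $G_{r+1}$ be the extension of $P$ by $M_r$ with cocycle $\tau_r$; that is, $G_{r+1} = M_r\times P$ as a set, with product $(t_1,g_1)(t_2,g_2) = (t_1 + {}^{g_1}t_2 + \tau_r(g_1,g_2),\, g_1g_2)$. (Every coclass family of $p$-groups arises in this way.) Let $\mathcal{E}$ be the set of triples $(U,f_\bullet,W)$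 where $U \le P$ is elementary abelian (possibly trivial), $f_\bullet$ is a cochain sequence of level at most $2m$ with $f_r\in C^1(U,M_r)$ and $\Delta(f_r) = \tau_r|_U$ for all $r \ge r_0$, and $W$ is a subgroup of $(T/pT)^U$. For such a triple, let $$E_r(U,f_\bullet,W) = \{(p^r w - f_r(u), u) \mid w \in W,\ u \in U\} \le G_{r+1},$$ where $p^r\colon T/pT \to M_r$ is induced by multiplication by $p^r$, and let $j_r^f\colon W\times U \to E_r(U,f_\bullet,W)$ be the isomorphism $(w,u)\mapsto (p^r w - f_r(u),u)$. These subgroups are elementary abelian. Let $(U,f_\bullet,W)$ and $(U',f'_\bullet,W')$ be in $\mathcal{E}$. Then the following hold, where $r$ ranges over the integers $r\ge r_0$. 1. The set of isomorphisms $W\times U \to W'\times U'$ of the form $(j_r^{f'})^{-1}\circ c\circ j_r^f$, where $c\colon E_r(U,f_\bullet,W)\to E_r(U',f'_\bullet,W')$ is an isomorphism given by conjugation by an element of $G_{r+1}$, is independent of $r$. 2. $E_r(U,f_\bullet,W)$ and $E_r(U',f'_\bullet,W')$ are conjugate in $G_{r+1}$ for some $r$ if and only if they are conjugate in $G_{r+1}$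 for every $r$. 3. The set of homomorphisms $W\times U \to W'\times U'$ of the form $(j_r^{f'})^{-1}\circ \varphi\circ j_r^f$, where $\varphi\colon E_r(U,f_\bullet,W)\to E_r(U',f'_\bullet,W')$ is a morphism in the Quillen category $\mathscr{A}_p(G_{r+1})$, is independent of $r$. (The objects of $\mathscr{A}_p(G)$ are the elementary abelian $p$-subgroups of $G$; its morphisms are the group homomorphisms induced by conjugation by elements of $G$.) -/

import Mathlib

namespace CoclassFamily

open CategoryTheory

section Lattice

/-! ### The modules `T / pⁿT` -/

/-- The subgroup `pⁿT` of `T`. -/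
def pPow (p : ℕ) (T : Type*) [AddCommGroup T] (n : ℕ) : AddSubgroup T :=
  (nsmulAddMonoidHom (α := T) (p ^ n)).range

/-- The quotient `T / pⁿT`. -/
def TMod (p : ℕ) (T : Type*) [AddCommGroup T] (n : ℕ) : Type _ := T ⧸ pPow p T n

instance (p : ℕ) (T : Type*) [AddCommGroup T] (n : ℕ) : AddCommGroup (TMod p T n) :=
  inferInstanceAs (AddCommGroup (T ⧸ pPow p T n))

/-- The projection `T → T / pⁿT`. -/
def TMod.mk (p : ℕ) {T : Type*} [AddCommGroup T] (n : ℕ) : T →+ TMod p T n :=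
  QuotientAddGroup.mk' (pPow p T n)

theorem mem_pPow {p : ℕ} {T : Type*} [AddCommGroup T] {n : ℕ} {x : T} :
    x ∈ pPow p T n ↔ ∃ y : T, p ^ n • y = x := Iff.rfl

theorem TMod.mk_surjective (p : ℕ) {T : Type*} [AddCommGroup T] (n : ℕ) :
    Function.Surjective (TMod.mk p (T := T) n) := QuotientAddGroup.mk'_surjective _

theorem TMod.mk_eq_zero {p : ℕ} {T : Type*} [AddCommGroup T] {n : ℕ} {x : T} :
    TMod.mk p n x = 0 ↔ x ∈ pPow p T n := QuotientAddGroup.eq_zero_iff x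

/-- The action of a group on `T / pⁿT` induced by an action on `T`. -/
instance (p : ℕ) (T : Type*) [AddCommGroup T] (n : ℕ) (G : Type*) [Group G]
    [DistribMulAction G T] : DistribMulAction G (TMod p T n) where
  smul g := QuotientAddGroup.map (pPow p T n) (pPow p T n) (DistribSMul.toAddMonoidHom T g)
    (by rintro _ ⟨y, rfl⟩; exact ⟨g • y, (smul_comm g (p ^ n) y).symm⟩)
  one_smul x := by
    obtain ⟨x, rfl⟩ := TMod.mk_surjective p n x
    exact congrArg (TMod.mk p n) (one_smul G x)
  mul_smul g h x := by
    obtain ⟨x, rfl⟩ := TMod.mk_surjective p n x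
    exact congrArg (TMod.mk p n) (mul_smul g h x)
  smul_zero g := map_zero (QuotientAddGroup.map _ _ _ _)
  smul_add g x y := map_add (QuotientAddGroup.map _ _ _ _) x y

theorem TMod.smul_mk (p : ℕ) {T : Type*} [AddCommGroup T] (n : ℕ) {G : Type*} [Group G]
    [DistribMulAction G T] (g : G) (x : T) : g • TMod.mk p n x = TMod.mk p n (g • x) := rfl

/-- The map `T / pT → T / pʳ⁺¹T`, `x + pT ↦ pʳx + pʳ⁺¹T`. -/
def mulP (p : ℕ) (T : Type*) [AddCommGroup T] (r : ℕ) : TMod p T 1 →+ TMod p T (r + 1) :=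
  QuotientAddGroup.map (pPow p T 1) (pPow p T (r + 1)) (nsmulAddMonoidHom (p ^ r))
    (by rintro _ ⟨y, rfl⟩; exact ⟨y, by simp [pow_succ, mul_smul]⟩)

theorem mulP_mk (p : ℕ) {T : Type*} [AddCommGroup T] (r : ℕ) (x : T) :
    mulP p T r (TMod.mk p 1 x) = TMod.mk p (r + 1) (p ^ r • x) := rfl

theorem mulP_smul (p : ℕ) {T : Type*} [AddCommGroup T] (r : ℕ) {G : Type*} [Group G]
    [DistribMulAction G T] (g : G) (x : TMod p T 1) :
    mulP p T r (g • x) = g • mulP p T r x := by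
  obtain ⟨x, rfl⟩ := TMod.mk_surjective p 1 x
  simp only [TMod.smul_mk, mulP_mk, smul_comm g (p ^ r) x]

theorem nsmul_TMod_one (p : ℕ) {T : Type*} [AddCommGroup T] (x : TMod p T 1) : p • x = 0 := by
  obtain ⟨x, rfl⟩ := TMod.mk_surjective p 1 x
  rw [← map_nsmul, TMod.mk_eq_zero]
  exact ⟨x, by simp⟩

theorem mulP_injective (p : ℕ) [Fact p.Prime] {T : Type*} [AddCommGroup T] [Module ℤ_[p] T]
    [Module.Free ℤ_[p] T] (r : ℕ) : Function.Injective (mulP p T r) := by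
  rw [injective_iff_map_eq_zero]
  intro x hx
  obtain ⟨x, rfl⟩ := TMod.mk_surjective p 1 x
  rw [mulP_mk, TMod.mk_eq_zero] at hx
  obtain ⟨y, hy⟩ := hx
  rw [TMod.mk_eq_zero]
  refine ⟨y, ?_⟩
  have h : p ^ r • (p ^ 1 • y) = p ^ r • x := by
    rw [← hy, nsmulAddMonoidHom_apply, smul_smul, ← pow_add]
  have hp : ((p ^ r : ℕ) : ℤ_[p]) ≠ 0 := by
    exact_mod_cast pow_ne_zero r (Fact.out : p.Prime).ne_zero
  rw [← Nat.cast_smul_eq_nsmul ℤ_[p] (p ^ r), ← Nat.cast_smul_eq_nsmul ℤ_[p] (p ^ r)] at h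
  exact smul_right_injective T hp h

end Lattice

section Cochains

/-! ### Normalized cochains in low degrees -/

/-- The coboundary of a `1`-cochain. -/
def delta₁ {G M : Type*} [Group G] [AddCommGroup M] [DistribMulAction G M] (f : G → M) :
    G → G → M :=
  fun a b => a • f b - f (a * b) + f a

/-- The coboundary of a `2`-cochain. -/
def delta₂ {G M : Type*} [Group G] [AddCommGroup M] [DistribMulAction G M] (f : G → G → M) :
    G → G → G → M :=
  fun a b c => a • f b c - f (a * b) c + f a (b * c) - f a b

/-- Normalized `1`-cochains. -/
def IsNormalized₁ {G M : Type*} [Group G] [AddCommGroup M] (f : G → M) : Prop := f 1 = 0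

/-- Normalized `2`-cochains. -/
def IsNormalized₂ {G M : Type*} [Group G] [AddCommGroup M] (f : G → G → M) : Prop :=
  ∀ a : G, f 1 a = 0 ∧ f a 1 = 0

/-- The group `Z²(G, M)` of normalized `2`-cocycles (as a set). -/
structure Cocycle₂ (G M : Type*) [Group G] [AddCommGroup M] [DistribMulAction G M] where
  toFun : G → G → M
  normalized : IsNormalized₂ toFun
  cocycle : delta₂ toFun = 0

/-- A sequence `(α_r)_{r ≥ r₀}` of `1`-cochains `α_r ∈ C¹(G, T / pʳ⁺¹T)` is an infinite cochain
sequence of level at most `k` (with respect to the submodule `N = pT` of `T`): for some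
`ω ≤ r₀` with `ω ≤ k` it is given by the classes of `ρ + p ^ (r - ω) • σ` for some
`ρ ∈ C¹(G, T)` and `σ ∈ C¹(G, pT)`. -/
def LevelLE₁ (p : ℕ) {T : Type*} [AddCommGroup T] {G : Type*} [Group G] {r₀ : ℕ} (k : ℕ)
    (α : ∀ r : Set.Ici r₀, G → TMod p T (r + 1)) : Prop :=
  ∃ ω : ℕ, ω ≤ k ∧ ω ≤ r₀ ∧ ∃ ρ σ : G → T,
    IsNormalized₁ ρ ∧ IsNormalized₁ σ ∧ (∀ g, σ g ∈ pPow p T 1) ∧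
    ∀ (r : Set.Ici r₀) (g : G), α r g = TMod.mk p (r + 1) (ρ g + p ^ ((r : ℕ) - ω) • σ g)

/-- The same notion for sequences of `2`-cochains. -/
def LevelLE₂ (p : ℕ) {T : Type*} [AddCommGroup T] {G : Type*} [Group G] {r₀ : ℕ} (k : ℕ)
    (α : ∀ r : Set.Ici r₀, G → G → TMod p T (r + 1)) : Prop :=
  ∃ ω : ℕ, ω ≤ k ∧ ω ≤ r₀ ∧ ∃ ρ σ : G → G → T,
    IsNormalized₂ ρ ∧ IsNormalized₂ σ ∧ (∀ g h, σ g h ∈ pPow p T 1) ∧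
    ∀ (r : Set.Ici r₀) (g h : G),
      α r g h = TMod.mk p (r + 1) (ρ g h + p ^ ((r : ℕ) - ω) • σ g h)

theorem LevelLE₁.map_one {p : ℕ} {T : Type*} [AddCommGroup T] {G : Type*} [Group G] {r₀ k : ℕ}
    {α : ∀ r : Set.Ici r₀, G → TMod p T (r + 1)} (h : LevelLE₁ p k α) (r : Set.Ici r₀) :
    α r 1 = 0 := by
  obtain ⟨ω, -, -, ρ, σ, hρ, hσ, -, h⟩ := h
  rw [h, show ρ 1 = 0 from hρ, show σ 1 = 0 from hσ, smul_zero, add_zero, map_zero]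

end Cochains

section Extension

/-! ### The extension of `G` by `M` with a given cocycle -/

/-- The extension `M . G` with cocycle `τ`: the underlying set is `M × G`. -/
@[ext]
structure Ext {G M : Type*} [Group G] [AddCommGroup M] [DistribMulAction G M]
    (τ : Cocycle₂ G M) where
  fst : M
  snd : G

variable {G M : Type*} [Group G] [AddCommGroup M] [DistribMulAction G M] (τ : Cocycle₂ G M)

instance : Mul (Ext τ) :=
  ⟨fun x y => ⟨x.fst + x.snd • y.fst + τ.toFun x.snd y.snd, x.snd * y.snd⟩⟩

instance : One (Ext τ) := ⟨⟨0, 1⟩⟩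

instance : Inv (Ext τ) := ⟨fun x => ⟨-(x.snd⁻¹ • x.fst) - τ.toFun x.snd⁻¹ x.snd, x.snd⁻¹⟩⟩

theorem Ext.mul_def (x y : Ext τ) :
    x * y = ⟨x.fst + x.snd • y.fst + τ.toFun x.snd y.snd, x.snd * y.snd⟩ := rfl

theorem Ext.one_def : (1 : Ext τ) = ⟨0, 1⟩ := rfl

theorem Ext.inv_def (x : Ext τ) :
    x⁻¹ = ⟨-(x.snd⁻¹ • x.fst) - τ.toFun x.snd⁻¹ x.snd, x.snd⁻¹⟩ := rfl

instance : Group (Ext τ) :=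
  Group.ofLeftAxioms
    (by
      intro x y z
      have h : delta₂ τ.toFun x.snd y.snd z.snd = 0 := by rw [τ.cocycle]; rfl
      simp only [delta₂] at h
      ext
      · simp only [Ext.mul_def, smul_add, mul_smul]
        rw [← sub_eq_zero, ← neg_eq_zero, ← h]
        abel
      · simp only [Ext.mul_def, mul_assoc])
    (by
      intro x
      ext
      · simp [Ext.mul_def, Ext.one_def, (τ.normalized x.snd).1]
      · simp [Ext.mul_def, Ext.one_def])
    (by
      intro x
      ext
      · simp only [Ext.mul_def, Ext.one_def, Ext.inv_def]
        abel
      · simp [Ext.mul_def, Ext.one_def, Ext.inv_def])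

end Extension

section Quillen

/-! ### Elementary abelian groups and the Quillen category -/

/-- Elementary abelian `p`-groups (the trivial group is one of them). -/
def IsElementaryAbelian (p : ℕ) (E : Type*) [Group E] : Prop :=
  (∀ a b : E, a * b = b * a) ∧ ∀ a : E, a ^ p = 1

/-- The objects of the Quillen category of `G` at `p`: the elementary abelian `p`-subgroups. -/
structure QuillenCat (p : ℕ) (G : Type*) [Group G] where
  carrier : Subgroup G
  elementary : IsElementaryAbelian p carrier

/-- The morphisms of the Quillen category: the group homomorphisms induced by conjugation with
an element of `G`. -/
@[ext]
structure QuillenCat.Hom {p : ℕ} {G : Type*} [Group G] (D E : QuillenCat p G) where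
  toHom : D.carrier →* E.carrier
  conj : ∃ x : G, ∀ a : D.carrier, (toHom a : G) = x * a * x⁻¹

instance (p : ℕ) (G : Type*) [Group G] : Category (QuillenCat p G) where
  Hom D E := QuillenCat.Hom D E
  id D := ⟨MonoidHom.id _, 1, fun a => by simp⟩
  comp φ ψ := ⟨ψ.toHom.comp φ.toHom, by
    obtain ⟨x, hx⟩ := φ.conj
    obtain ⟨y, hy⟩ := ψ.conj
    exact ⟨y * x, fun a => by
      rw [MonoidHom.comp_apply, hy, hx, mul_inv_rev]
      simp only [mul_assoc]⟩⟩

end Quillen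

section Triples

/-! ### Elementary abelian subgroups of the groups of the family -/

variable {p : ℕ} {P T : Type*} [Group P] [AddCommGroup T] [DistribMulAction P T] {r₀ : ℕ}

/-- The set `𝓔` of triples `(U, f, W)`, for the family of extensions of `P` by `T / pʳ⁺¹T`
(`r ≥ r₀`) with cocycles `τ_r`, where `|P| = pᵐ`. -/
structure Triple (m : ℕ) (τ : ∀ r : Set.Ici r₀, Cocycle₂ P (TMod p T (r + 1))) where
  U : Subgroup P
  elementary : IsElementaryAbelian p U
  f : ∀ r : Set.Ici r₀, U → TMod p T (r + 1)
  level : LevelLE₁ p (2 * m) f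
  delta_f : ∀ (r : Set.Ici r₀) (u v : U), delta₁ (f r) u v = (τ r).toFun u v
  W : AddSubgroup (TMod p T 1)
  fixed : ∀ w ∈ W, ∀ u ∈ U, u • w = w

namespace Triple

variable {m : ℕ} {τ : ∀ r : Set.Ici r₀, Cocycle₂ P (TMod p T (r + 1))}

/-- The element `(pʳw - f_r(u), u)` of the extension with cocycle `τ_r`. -/
def elt (X : Triple m τ) (r : Set.Ici r₀) (w : X.W) (u : X.U) : Ext (τ r) :=
  ⟨mulP p T r w - X.f r u, u⟩

theorem elt_mul (X : Triple m τ) (r : Set.Ici r₀) (w w' : X.W) (u u' : X.U) :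
    X.elt r (w + w') (u * u') = X.elt r w u * X.elt r w' u' := by
  ext
  · have h1 : (u : P) • mulP p T r (w' : TMod p T 1) = mulP p T r (w' : TMod p T 1) := by
      rw [← mulP_smul, X.fixed w' w'.2 u u.2]
    simp only [elt, Ext.mul_def, smul_sub, h1, ← X.delta_f, delta₁, Subgroup.smul_def,
      AddSubgroup.coe_add, map_add]
    abel
  · rfl

theorem elt_one (X : Triple m τ) (r : Set.Ici r₀) : X.elt r 0 1 = 1 := by
  ext
  · simp [elt, Ext.one_def, X.level.map_one r]
  · rfl

/-- The homomorphism `W × U → G_{r+1}`, `(w, u) ↦ (pʳw - f_r(u), u)`. -/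
def toExt (X : Triple m τ) (r : Set.Ici r₀) : Multiplicative X.W × X.U →* Ext (τ r) where
  toFun a := X.elt r a.1.toAdd a.2
  map_one' := X.elt_one r
  map_mul' _ _ := X.elt_mul r _ _ _ _

/-- The subgroup `E_r(U, f, W) = {(pʳw - f_r(u), u) | w ∈ W, u ∈ U}`. -/
def E (X : Triple m τ) (r : Set.Ici r₀) : Subgroup (Ext (τ r)) := (X.toExt r).range

theorem toExt_injective [Fact p.Prime] [Module ℤ_[p] T] [Module.Free ℤ_[p] T]
    (X : Triple m τ) (r : Set.Ici r₀) : Function.Injective (X.toExt r) := by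
  rw [injective_iff_map_eq_one]
  rintro ⟨w, u⟩ h
  have h2 : (u : P) = 1 := congrArg Ext.snd h
  have h2 : u = 1 := Subtype.ext h2
  subst h2
  have h1 : mulP p T r (w.toAdd : TMod p T 1) - X.f r 1 = 0 := congrArg Ext.fst h
  rw [X.level.map_one r, sub_zero] at h1
  have h3 := (injective_iff_map_eq_zero _).1 (mulP_injective p (T := T) r) _ h1
  have h4 : w.toAdd = 0 := Subtype.ext h3
  exact Prod.ext h4 rfl

/-- The isomorphism `j_r^f : W × U → E_r(U, f, W)`, `(w, u) ↦ (pʳw - f_r(u), u)`. -/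
noncomputable def j [Fact p.Prime] [Module ℤ_[p] T] [Module.Free ℤ_[p] T]
    (X : Triple m τ) (r : Set.Ici r₀) : Multiplicative X.W × X.U ≃* X.E r :=
  MonoidHom.ofInjective (X.toExt_injective r)

theorem E_elementary (X : Triple m τ) (r : Set.Ici r₀) : IsElementaryAbelian p (X.E r) := by
  constructor
  · rintro ⟨_, a, rfl⟩ ⟨_, b, rfl⟩
    refine Subtype.ext ?_
    change X.toExt r a * X.toExt r b = X.toExt r b * X.toExt r a
    rw [← map_mul, ← map_mul]
    exact congrArg _ (Prod.ext (mul_comm _ _) (X.elementary.1 _ _))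
  · rintro ⟨_, a, rfl⟩
    refine Subtype.ext ?_
    change X.toExt r a ^ p = 1
    rw [← map_pow, ← map_one (X.toExt r)]
    refine congrArg _ (Prod.ext ?_ (X.elementary.2 _))
    exact Subtype.ext (nsmul_TMod_one p (a.1.toAdd : TMod p T 1))

/-- `E_r(U, f, W)` as an object of the Quillen category of `G_{r+1}`. -/
def quillenObj (X : Triple m τ) (r : Set.Ici r₀) : QuillenCat p (Ext (τ r)) :=
  ⟨X.E r, X.E_elementary r⟩

/-- The subgroups `E_r(U, f, W)` and `E_r(U', f', W')` are conjugate in `G_{r+1}`. -/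
def AreConj (X Y : Triple m τ) (r : Set.Ici r₀) : Prop :=
  ∃ x : Ext (τ r), (X.E r).map (MulAut.conj x).toMonoidHom = Y.E r

/-- The isomorphism `E_r(U, f, W) → E_r(U', f', W')`, `a ↦ x a x⁻¹`, if `x` conjugates the first
subgroup to the second. -/
def conjEquiv (X Y : Triple m τ) (r : Set.Ici r₀) (x : Ext (τ r))
    (h : (X.E r).map (MulAut.conj x).toMonoidHom = Y.E r) : X.E r ≃* Y.E r :=
  ((MulAut.conj x).subgroupMap (X.E r)).trans (MulEquiv.subgroupCongr h)

/-- The set of isomorphisms `W × U → W' × U'` of the form `j_r^f`, followed by conjugation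
`E_r(U, f, W) → E_r(U', f', W')` in `G_{r+1}`, followed by the inverse of `j_r^f'`. -/
def conjIsos [Fact p.Prime] [Module ℤ_[p] T] [Module.Free ℤ_[p] T]
    (X Y : Triple m τ) (r : Set.Ici r₀) :
    Set (Multiplicative X.W × X.U ≃* Multiplicative Y.W × Y.U) :=
  {F | ∃ (x : Ext (τ r)) (h : (X.E r).map (MulAut.conj x).toMonoidHom = Y.E r),
    F = ((X.j r).trans (X.conjEquiv Y r x h)).trans (Y.j r).symm}

/-- The set of homomorphisms `W × U → W' × U'` of the form `j_r^f`, followed by a morphism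
`E_r(U, f, W) → E_r(U', f', W')` in the Quillen category of `G_{r+1}`, followed by the inverse
of `j_r^f'`. -/
def quillenHoms [Fact p.Prime] [Module ℤ_[p] T] [Module.Free ℤ_[p] T]
    (X Y : Triple m τ) (r : Set.Ici r₀) :
    Set (Multiplicative X.W × X.U →* Multiplicative Y.W × Y.U) :=
  {F | ∃ φ : X.quillenObj r ⟶ Y.quillenObj r,
    F = (Y.j r).symm.toMonoidHom.comp ((QuillenCat.Hom.toHom φ).comp (X.j r).toMonoidHom)}

end Triple

end Triples

end CoclassFamily

/-! A homomorphism `F : W × U → W' × U'` is induced by conjugation with `(t, g)` exactly when three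
conditions hold (`induces_iff`): `F` acts on `W` as `g`; `g u = φ(u) g`, where `φ = homU F`; and the
cochain `β_r = obstruction X Y F g r` on `U` satisfies `β_r(u) = t - φ(u) t`. Only the third
involves `r`, so for fixed `F` and `g` the question is whether `β_r` is a coboundary for the action
through `φ`.

The `β_r` are cocycles of the form `ρ + p^(r-2m) σ` mod `p^(r+1)`, and `coboundary_of_coboundary`
shows that for such a family being a coboundary at one `r` implies it at every `s`. The point is
that `r - 2m ≥ m`, so `p^(r-2m)` is a multiple of `|U|` and kills `H¹(U, T)`. All three claims
follow, since each concerns only which `F` are induced by some element. -/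

namespace CoclassFamily

/-! ### Torsion-freeness and `p`-adic separatedness of `T`. -/

section Lattice

variable {p : ℕ} [Fact p.Prime] {T : Type*} [AddCommGroup T] [Module ℤ_[p] T]

theorem pow_nsmul_injective [Module.Free ℤ_[p] T] (n : ℕ) : Function.Injective fun x : T => p ^ n • x := by
  intro x y h
  have hp : ((p ^ n : ℕ) : ℤ_[p]) ≠ 0 := by
    exact_mod_cast pow_ne_zero n (Fact.out : p.Prime).ne_zero
  simp only [← Nat.cast_smul_eq_nsmul ℤ_[p] (p ^ n)] at h
  exact smul_right_injective T hp h

/-- Krull's intersection theorem over the local ring `ℤ_[p]`. -/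
theorem eq_zero_of_forall_mem_pPow [Module.Finite ℤ_[p] T] {x : T}
    (h : ∀ n, x ∈ pPow p T n) : x = 0 := by
  have hI : Ideal.span {(p : ℤ_[p])} ≠ ⊤ := by
    rw [← PadicInt.maximalIdeal_eq_span_p]
    exact Ideal.IsMaximal.ne_top inferInstance
  have hH : IsHausdorff (Ideal.span {(p : ℤ_[p])}) T := IsHausdorff.of_isLocalRing _ T hI
  refine hH.haus x fun n => ?_
  rw [SModEq.zero]
  obtain ⟨y, rfl⟩ := h n
  rw [nsmulAddMonoidHom_apply, ← Nat.cast_smul_eq_nsmul ℤ_[p], Nat.cast_pow]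
  exact Submodule.smul_mem_smul (Ideal.pow_mem_pow (Ideal.mem_span_singleton_self _) n) trivial

end Lattice

/-! ### First cohomology and change of `r`. -/

section Cohomology

variable {p : ℕ} {P T V : Type*} [Group P] [AddCommGroup T] [DistribMulAction P T] [Group V]

/-- The cardinality of a finite group annihilates its first cohomology. -/
theorem exists_card_nsmul_eq [Finite V] (φ : V →* P) (μ : V → T)
    (hμ : ∀ u v, φ u • μ v - μ (u * v) + μ u = 0) {n : ℕ} (hn : Nat.card V ∣ n) :
    ∃ s : T, ∀ v, n • μ v = s - φ v • s := by
  cases nonempty_fintype V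
  obtain ⟨c, rfl⟩ := hn
  refine ⟨c • ∑ v, μ v, fun v => ?_⟩
  -- Sum the cocycle identity for `(v, w)` over all `w`.
  have h : φ v • ∑ w, μ w - ∑ w, μ w + Nat.card V • μ v = 0 := by
    calc _ = ∑ w, (φ v • μ w - μ (v * w) + μ v) := by
          rw [Finset.sum_add_distrib, Finset.sum_sub_distrib, Finset.smul_sum,
            Fintype.sum_equiv (Equiv.mulLeft v) (fun w => μ (v * w)) μ fun _ => rfl]
          simp
      _ = 0 := by simp [hμ]
  rw [smul_comm (φ v) c, ← smul_sub, mul_comm, mul_smul]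
  congr 1
  rw [← sub_eq_zero, ← h]
  abel

/-- Over `T` itself, `ρ` is a cocycle, and a trivialization at `r` corrects `σ` modulo `p^(2m+1)` to
a cocycle `μ`. Multiples of `μ` by `p^(q-2m)` are coboundaries for every `q`, hence so is `ρ`, and
`ρ + p^(s-2m) μ` represents `β s`. -/
theorem coboundary_of_coboundary [Fact p.Prime] [Module ℤ_[p] T] [Module.Free ℤ_[p] T]
    [Module.Finite ℤ_[p] T] [Finite V] (φ : V →* P) {m r₀ : ℕ} (hV : Nat.card V ∣ p ^ m)
    (hr₀ : 3 * m ≤ r₀) (ρ σ : V → T) (β : ∀ r : Set.Ici r₀, V → TMod p T (r + 1))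
    (hβ : ∀ r v, β r v = TMod.mk p (r + 1) (ρ v + p ^ ((r : ℕ) - 2 * m) • σ v))
    (hco : ∀ r u v, φ u • β r v - β r (u * v) + β r u = 0) {r : Set.Ici r₀}
    (hr : ∃ t : TMod p T (r + 1), ∀ v, β r v = t - φ v • t) (s : Set.Ici r₀) :
    ∃ t : TMod p T (s + 1), ∀ v, β s v = t - φ v • t := by
  have hsplit (q : Set.Ici r₀) : p ^ ((q : ℕ) + 1) = p ^ ((q : ℕ) - 2 * m) * p ^ (2 * m + 1) := by
    rw [← pow_add]
    congr 1
    have : r₀ ≤ q := q.2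
    omega
  have hρ (u v : V) : φ u • ρ v - ρ (u * v) + ρ u = 0 := by
    -- The identity for `β q` gives the one for `ρ` modulo `p^(q-2m)`; this exponent is unbounded in
    -- `q`, and `q = r₀ + n` makes it at least `n`.
    refine eq_zero_of_forall_mem_pPow (p := p) fun n => ?_
    let q : Set.Ici r₀ := ⟨r₀ + n, Nat.le_add_right _ _⟩
    have hq : (q : ℕ) - 2 * m = n + (r₀ - 2 * m) := by simp only [q]; omega
    have h := hco q u v
    simp only [hβ, TMod.smul_mk, ← map_sub, ← map_add] at h
    obtain ⟨y, hy⟩ := TMod.mk_eq_zero.1 h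
    rw [nsmulAddMonoidHom_apply, hsplit q, mul_smul, smul_add, smul_comm (φ u)] at hy
    refine ⟨p ^ (r₀ - 2 * m) • (p ^ (2 * m + 1) • y - (φ u • σ v - σ (u * v) + σ u)), ?_⟩
    rw [nsmulAddMonoidHom_apply, smul_smul, ← pow_add, ← hq, smul_sub, hy]
    simp only [smul_sub, smul_add]
    abel
  obtain ⟨t, ht⟩ := hr
  obtain ⟨t, rfl⟩ := TMod.mk_surjective p _ t
  have hκ (v : V) : ∃ κ : T,
      ρ v + p ^ ((r : ℕ) - 2 * m) • σ v - (t - φ v • t) = p ^ ((r : ℕ) + 1) • κ := by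
    have h := ht v
    rw [hβ, TMod.smul_mk, ← map_sub, ← sub_eq_zero, ← map_sub] at h
    obtain ⟨y, hy⟩ := TMod.mk_eq_zero.1 h
    exact ⟨y, hy.symm⟩
  choose κ hκ using hκ
  let μ : V → T := fun v => σ v - p ^ (2 * m + 1) • κ v
  have hμρ (v : V) : p ^ ((r : ℕ) - 2 * m) • μ v = t - φ v • t - ρ v := by
    simp only [μ]
    rw [smul_sub, smul_smul, ← hsplit, ← hκ]
    abel
  have hμ (u v : V) : φ u • μ v - μ (u * v) + μ u = 0 := by
    -- After multiplication by `p^(r-2m)`, `μ` becomes a coboundary minus the cocycle `ρ`; `T` is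
    -- torsion-free.
    apply pow_nsmul_injective (p := p) (T := T) ((r : ℕ) - 2 * m)
    simp only [smul_zero]
    rw [smul_add, smul_sub, smul_comm _ (φ u), hμρ, hμρ, hμρ, ← neg_eq_zero, ← hρ u v]
    simp only [smul_sub, map_mul, mul_smul]
    abel
  have hkill (q : Set.Ici r₀) : ∃ z : T, ∀ v, p ^ ((q : ℕ) - 2 * m) • μ v = z - φ v • z := by
    refine exists_card_nsmul_eq φ μ hμ (hV.trans (pow_dvd_pow p ?_))
    have : r₀ ≤ q := q.2
    omega
  obtain ⟨a, ha⟩ := hkill r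
  obtain ⟨b, hb⟩ := hkill s
  -- `t - a` trivializes `ρ`, and `b` trivializes `p^(s-2m) σ` up to `p^(s+1) κ`.
  refine ⟨TMod.mk p _ (t - a + b), fun v => ?_⟩
  rw [hβ, TMod.smul_mk, ← map_sub, ← sub_eq_zero, ← map_sub, TMod.mk_eq_zero]
  refine ⟨κ v, ?_⟩
  have h1 : ρ v = t - φ v • t - (a - φ v • a) := by rw [← ha, hμρ]; abel
  have h2 : p ^ ((s : ℕ) - 2 * m) • σ v
      = b - φ v • b + p ^ ((s : ℕ) + 1) • κ v := by
    rw [← hb, hsplit, mul_smul, ← smul_add]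
    simp [μ]
  rw [h1, h2, nsmulAddMonoidHom_apply]
  simp only [smul_add, smul_sub]
  abel

end Cohomology

/-! ### Lifts of cochain sequences with a prescribed exponent. -/

section Levels

variable {p : ℕ} {T : Type*} [AddCommGroup T] {G : Type*} [Group G] {r₀ k l : ℕ}

/-- The factor `p^(l-ω)` is absorbed into `σ`, so that sequences of different levels can be added
with one common exponent `r - l`. -/
theorem LevelLE₁.exists_lift {α : ∀ r : Set.Ici r₀, G → TMod p T (r + 1)}
    (h : LevelLE₁ p k α) (hkl : k ≤ l) (hl : l ≤ r₀) :
    ∃ ρ σ : G → T, ∀ r g, α r g = TMod.mk p (r + 1) (ρ g + p ^ ((r : ℕ) - l) • σ g) := by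
  obtain ⟨ω, hω, -, ρ, σ, -, -, -, h⟩ := h
  refine ⟨ρ, fun g => p ^ (l - ω) • σ g, fun r g => ?_⟩
  have : r₀ ≤ r := r.2
  rw [h, smul_smul, ← pow_add, show (r : ℕ) - l + (l - ω) = r - ω by omega]

theorem LevelLE₂.exists_lift {α : ∀ r : Set.Ici r₀, G → G → TMod p T (r + 1)}
    (h : LevelLE₂ p k α) (hkl : k ≤ l) (hl : l ≤ r₀) :
    ∃ ρ σ : G → G → T,
      ∀ r g h, α r g h = TMod.mk p (r + 1) (ρ g h + p ^ ((r : ℕ) - l) • σ g h) := by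
  obtain ⟨ω, hω, -, ρ, σ, -, -, -, h⟩ := h
  refine ⟨ρ, fun g h => p ^ (l - ω) • σ g h, fun r g g' => ?_⟩
  have : r₀ ≤ r := r.2
  rw [h, smul_smul, ← pow_add, show (r : ℕ) - l + (l - ω) = r - ω by omega]

end Levels

/-! ### Conjugation in the extensions and its obstruction cocycle. -/

namespace Triple

variable {p : ℕ} {P T : Type*} [Group P] [AddCommGroup T] [DistribMulAction P T] {r₀ : ℕ}
  {m : ℕ} {τ : ∀ r : Set.Ici r₀, Cocycle₂ P (TMod p T (r + 1))}

/-- Conjugation by `x` induces the homomorphism `F`. -/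
def Induces (X Y : Triple m τ) (r : Set.Ici r₀)
    (F : Multiplicative X.W × X.U →* Multiplicative Y.W × Y.U) (x : Ext (τ r)) : Prop :=
  ∀ a, x * X.toExt r a = Y.toExt r (F a) * x

/-- The `U`-component of the restriction of `F` to `U`. -/
def homU {X Y : Triple m τ} (F : Multiplicative X.W × X.U →* Multiplicative Y.W × Y.U) :
    X.U →* Y.U := (MonoidHom.snd _ _).comp (F.comp (MonoidHom.inr _ _))

/-- The `W`-component of the restriction of `F` to `U`. -/
def homW {X Y : Triple m τ} (F : Multiplicative X.W × X.U →* Multiplicative Y.W × Y.U) :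
    X.U →* Multiplicative Y.W := (MonoidHom.fst _ _).comp (F.comp (MonoidHom.inr _ _))

/-- The `1`-cochain on `U` which has to be the coboundary of `-t` for `(t, g)` to induce `F`. -/
def obstruction (X Y : Triple m τ) (F : Multiplicative X.W × X.U →* Multiplicative Y.W × Y.U)
    (g : P) (r : Set.Ici r₀) (u : X.U) : TMod p T (r + 1) :=
  mulP p T r ((homW F u).toAdd : TMod p T 1) - Y.f r (homU F u)
    + (τ r).toFun (homU F u) g + g • X.f r u - (τ r).toFun g u

theorem obstruction_cocycle (X Y : Triple m τ)
    (F : Multiplicative X.W × X.U →* Multiplicative Y.W × Y.U) {g : P}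
    (hg : ∀ u : X.U, g * u = homU F u * g) (r : Set.Ici r₀) (u v : X.U) :
    (homU F u : P) • obstruction X Y F g r v - obstruction X Y F g r (u * v)
      + obstruction X Y F g r u = 0 := by
  have hc (a b c : P) : delta₂ (τ r).toFun a b c = 0 := by rw [(τ r).cocycle]; rfl
  have h1 := hc g u v
  have h2 := hc (homU F u) g v
  have h3 := hc (homU F u) (homU F v) g
  have hX := congrArg (g • ·) (X.delta_f r u v)
  have hY := Y.delta_f r (homU F u) (homU F v)
  have hW : (homU F u : P) • mulP p T r ((homW F v).toAdd : TMod p T 1)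
      = mulP p T r ((homW F v).toAdd : TMod p T 1) := by
    rw [← mulP_smul, Y.fixed _ (homW F v).toAdd.2 _ (homU F u).2]
  simp only [delta₁, delta₂, smul_add, smul_sub, Subgroup.smul_def, ← hg, smul_smul]
    at h1 h2 h3 hX hY
  simp only [obstruction, smul_add, smul_sub, hW, map_mul, toAdd_mul, AddSubgroup.coe_add, map_add,
    Subgroup.coe_mul, smul_smul, ← hg]
  rw [← sub_eq_zero] at hX hY
  -- With `φ = homU F`, the sum combines the cocycle identities of `τ r` at `(φ u, φ v, g)`, `(g, u,
  -- v)` and `(φ u, g, v)` with `delta_f` for `X`, moved by `g`, and for `Y`.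
  calc _ = ((homU F u : P) • (τ r).toFun (homU F v) g - (τ r).toFun (homU F u * homU F v) g
          + (τ r).toFun (homU F u) (g * v) - (τ r).toFun (homU F u) (homU F v))
        + (g • (τ r).toFun u v - (τ r).toFun (g * u) v + (τ r).toFun g (u * v) - (τ r).toFun g u)
        - ((homU F u : P) • (τ r).toFun g v - (τ r).toFun (g * u) v
          + (τ r).toFun (homU F u) (g * v) - (τ r).toFun (homU F u) g)
        + ((g * u) • X.f r v - g • X.f r (u * v) + g • X.f r u - g • (τ r).toFun u v)
        - ((homU F u : P) • Y.f r (homU F v) - Y.f r (homU F u * homU F v) + Y.f r (homU F u)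
          - (τ r).toFun (homU F u) (homU F v)) := by abel
    _ = 0 := by rw [h1, h2, h3, hX, hY]; simp

theorem obstruction_lift (X Y : Triple m τ)
    (F : Multiplicative X.W × X.U →* Multiplicative Y.W × Y.U) (g : P) (hr₀ : 2 * m ≤ r₀)
    (hτ : LevelLE₂ p m (fun r => (τ r).toFun)) :
    ∃ ρ σ : X.U → T, ∀ r u,
      obstruction X Y F g r u = TMod.mk p (r + 1) (ρ u + p ^ ((r : ℕ) - 2 * m) • σ u) := by
  obtain ⟨ρ₁, σ₁, h₁⟩ := X.level.exists_lift le_rfl hr₀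
  obtain ⟨ρ₂, σ₂, h₂⟩ := Y.level.exists_lift le_rfl hr₀
  obtain ⟨ρ₃, σ₃, h₃⟩ := hτ.exists_lift (by omega) hr₀
  choose η hη using TMod.mk_surjective p (T := T) 1
  refine ⟨fun u => - ρ₂ (homU F u) + ρ₃ (homU F u) g + g • ρ₁ u - ρ₃ g u,
    fun u => p ^ (2 * m) • η (homW F u).toAdd - σ₂ (homU F u) + σ₃ (homU F u) g + g • σ₁ u
      - σ₃ g u, fun r u => ?_⟩
  have hr : r₀ ≤ r := r.2
  -- The term `p^r w` goes into the `σ`-part as `p^(r-2m) · p^(2m) w`.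
  have hw : mulP p T r ((homW F u).toAdd : TMod p T 1)
      = TMod.mk p (r + 1) (p ^ ((r : ℕ) - 2 * m) • p ^ (2 * m) • η (homW F u).toAdd) := by
    rw [smul_smul, ← pow_add, Nat.sub_add_cancel (hr₀.trans hr), ← mulP_mk, hη]
  rw [obstruction, hw, h₁, h₂, h₃, h₃, TMod.smul_mk]
  simp only [← map_add, ← map_sub]
  congr 1
  simp only [smul_add, smul_sub, smul_comm g]
  abel

theorem induces_iff [Fact p.Prime] [Module ℤ_[p] T] [Module.Free ℤ_[p] T] (X Y : Triple m τ)
    (r : Set.Ici r₀) (F : Multiplicative X.W × X.U →* Multiplicative Y.W × Y.U)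
    (t : TMod p T (r + 1)) (g : P) :
    X.Induces Y r F ⟨t, g⟩ ↔
      (∀ w : Multiplicative X.W, (F (w, 1)).2 = 1 ∧
        ((F (w, 1)).1.toAdd : TMod p T 1) = g • (w.toAdd : TMod p T 1)) ∧
      (∀ u : X.U, g * u = homU F u * g) ∧
      ∀ u : X.U, obstruction X Y F g r u = t - (homU F u : P) • t := by
  have hU (u : X.U) : (⟨t, g⟩ * X.toExt r (1, u) = Y.toExt r (F (1, u)) * ⟨t, g⟩) ↔
      g * u = homU F u * g ∧ obstruction X Y F g r u = t - (homU F u : P) • t := by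
    rw [Ext.ext_iff, and_comm]
    refine and_congr Iff.rfl ?_
    change t + g • (mulP p T r 0 - X.f r u) + (τ r).toFun g u
      = mulP p T r ((homW F u).toAdd : TMod p T 1) - Y.f r (homU F u) + (homU F u : P) • t
        + (τ r).toFun (homU F u) g ↔ _
    rw [obstruction, ← sub_eq_zero, ← neg_eq_zero, ← sub_eq_zero (b := t - _), map_zero, zero_sub,
      smul_neg]
    refine Eq.congr ?_ rfl
    abel
  -- Conjugation by `(t, g)` sends `(p^r w, 1)` to `(p^r (g w), 1)`, whatever `t` is, because the
  -- kernel is abelian; injectivity of `mulP` then removes `p^r`.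
  have hW (w : Multiplicative X.W) :
      (⟨t, g⟩ * X.toExt r (w, 1) = Y.toExt r (F (w, 1)) * ⟨t, g⟩) ↔
      (F (w, 1)).2 = 1 ∧
        ((F (w, 1)).1.toAdd : TMod p T 1) = g • (w.toAdd : TMod p T 1) := by
    have h2 : g * 1 = ((F (w, 1)).2 : P) * g ↔ (F (w, 1)).2 = 1 := by
      rw [mul_one, eq_comm, mul_eq_right, OneMemClass.coe_eq_one]
    rw [Ext.ext_iff, and_comm, ← h2]
    refine and_congr_right fun h => ?_
    have h := h2.1 h
    change t + g • (mulP p T r (w.toAdd : TMod p T 1) - X.f r 1) + (τ r).toFun g 1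
      = mulP p T r ((F (w, 1)).1.toAdd : TMod p T 1) - Y.f r (F (w, 1)).2
        + ((F (w, 1)).2 : P) • t + (τ r).toFun (F (w, 1)).2 g ↔ _
    rw [h, X.level.map_one, Y.level.map_one, OneMemClass.coe_one, ((τ r).normalized g).1,
      ((τ r).normalized g).2, one_smul, sub_zero, sub_zero, add_zero, add_zero,
      add_comm (mulP p T r _) t, add_right_inj, ← mulP_smul, (mulP_injective p r).eq_iff, eq_comm]
  constructor
  · intro h
    exact ⟨fun w => (hW w).1 (h _), fun u => ((hU u).1 (h _)).1, fun u => ((hU u).1 (h _)).2⟩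
  · rintro ⟨h1, h2, h3⟩ ⟨w, u⟩
    have hwu : (w, u) = (w, 1) * ((1, u) : Multiplicative X.W × X.U) := by simp
    rw [hwu, map_mul, map_mul, map_mul, ← mul_assoc, (hW w).2 (h1 w), mul_assoc,
      (hU u).2 ⟨h2 u, h3 u⟩, mul_assoc]

variable [Fact p.Prime] [Module ℤ_[p] T] [Module.Free ℤ_[p] T]

/-- The same `g` serves for every index; only `t` has to be replaced. -/
theorem exists_induces_of_exists_induces [Module.Finite ℤ_[p] T] (hP : Nat.card P = p ^ m)
    (hr₀ : 3 * m ≤ r₀) (hτ : LevelLE₂ p m (fun r => (τ r).toFun)) (X Y : Triple m τ)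
    {F : Multiplicative X.W × X.U →* Multiplicative Y.W × Y.U} {r : Set.Ici r₀}
    (h : ∃ x, X.Induces Y r F x) (s : Set.Ici r₀) : ∃ x, X.Induces Y s F x := by
  obtain ⟨⟨t, g⟩, h⟩ := h
  obtain ⟨h1, h2, h3⟩ := (induces_iff X Y r F t g).1 h
  have : Finite P := Nat.finite_of_card_ne_zero
    (by rw [hP]; exact pow_ne_zero m (Fact.out : p.Prime).ne_zero)
  obtain ⟨ρ, σ, hρσ⟩ := obstruction_lift X Y F g (by omega) hτ
  obtain ⟨t', ht'⟩ := coboundary_of_coboundary (Y.U.subtype.comp (homU F))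
    (hP ▸ X.U.card_subgroup_dvd_card) hr₀ ρ σ (obstruction X Y F g) hρσ
    (obstruction_cocycle X Y F h2) ⟨t, h3⟩ s
  exact ⟨⟨t', g⟩, (induces_iff X Y s F t' g).2 ⟨h1, h2, ht'⟩⟩

theorem mem_quillenHoms_iff (X Y : Triple m τ) (r : Set.Ici r₀)
    (F : Multiplicative X.W × X.U →* Multiplicative Y.W × Y.U) :
    F ∈ X.quillenHoms Y r ↔ ∃ x, X.Induces Y r F x := by
  constructor
  · rintro ⟨⟨φ, x, hx⟩, rfl⟩
    refine ⟨x, fun a => ?_⟩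
    have h : Y.toExt r ((Y.j r).symm (φ (X.j r a))) = φ (X.j r a) :=
      congrArg Subtype.val ((Y.j r).apply_symm_apply (φ (X.j r a)))
    change _ = Y.toExt r ((Y.j r).symm (φ (X.j r a))) * x
    rw [h]
    refine Eq.trans ?_ (congrArg (· * x) (hx (X.j r a))).symm
    exact (inv_mul_cancel_right (x * X.toExt r a) x).symm
  · rintro ⟨x, hx⟩
    refine ⟨⟨(Y.j r).toMonoidHom.comp (F.comp (X.j r).symm.toMonoidHom), x, fun a => ?_⟩, ?_⟩
    · obtain ⟨a, rfl⟩ := (X.j r).surjective a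
      change ((Y.j r (F ((X.j r).symm (X.j r a))) : Y.E r) : Ext (τ r)) = x * X.toExt r a * x⁻¹
      rw [MulEquiv.symm_apply_apply, hx, mul_inv_cancel_right]
      rfl
    · ext1 a
      change F a = (Y.j r).symm (Y.j r (F ((X.j r).symm (X.j r a))))
      rw [MulEquiv.symm_apply_apply, MulEquiv.symm_apply_apply]

theorem mem_conjIsos_iff (X Y : Triple m τ) (r : Set.Ici r₀)
    (F : Multiplicative X.W × X.U ≃* Multiplicative Y.W × Y.U) :
    F ∈ X.conjIsos Y r ↔ ∃ x, X.Induces Y r F.toMonoidHom x := by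
  constructor
  · rintro ⟨x, h, rfl⟩
    refine ⟨x, fun a => ?_⟩
    have h' : Y.toExt r ((Y.j r).symm (X.conjEquiv Y r x h (X.j r a)))
        = X.conjEquiv Y r x h (X.j r a) :=
      congrArg Subtype.val ((Y.j r).apply_symm_apply _)
    change _ = Y.toExt r ((Y.j r).symm (X.conjEquiv Y r x h (X.j r a))) * x
    rw [h']
    change _ = x * X.toExt r a * x⁻¹ * x
    rw [inv_mul_cancel_right]
  · rintro ⟨x, hx⟩
    have hx' (a) : x * X.toExt r a * x⁻¹ = Y.toExt r (F a) := by
      rw [hx, mul_inv_cancel_right]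
      rfl
    -- Surjectivity of `F` makes the conjugate all of `Y.E r`.
    have h : (X.E r).map (MulAut.conj x).toMonoidHom = Y.E r := by
      ext y
      constructor
      · rintro ⟨_, ⟨a, rfl⟩, rfl⟩
        exact ⟨F a, (hx' a).symm⟩
      · rintro ⟨b, rfl⟩
        refine ⟨_, ⟨F.symm b, rfl⟩, ?_⟩
        exact (hx' _).trans (by rw [MulEquiv.apply_symm_apply])
    refine ⟨x, h, ?_⟩
    ext1 a
    change F a = (Y.j r).symm (X.conjEquiv Y r x h (X.j r a))
    rw [MulEquiv.eq_symm_apply]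
    exact Subtype.ext (hx' a).symm

theorem areConj_iff (X Y : Triple m τ) (r : Set.Ici r₀) :
    X.AreConj Y r ↔ (X.conjIsos Y r).Nonempty :=
  ⟨fun ⟨x, h⟩ => ⟨_, x, h, rfl⟩, fun ⟨_, x, h, _⟩ => ⟨x, h⟩⟩

end Triple

end CoclassFamily

theorem mainTheorem6 (p : ℕ) [Fact p.Prime]
    (P : Type*) [Group P] (m : ℕ) (hP : Nat.card P = p ^ m)
    (T : Type*) [AddCommGroup T] [Module ℤ_[p] T] [Module.Free ℤ_[p] T] [Module.Finite ℤ_[p] T]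
    [DistribMulAction P T] [SMulCommClass P ℤ_[p] T]
    (r₀ : ℕ) (hr₀ : 3 * m ≤ r₀)
    (τ : ∀ r : Set.Ici r₀, CoclassFamily.Cocycle₂ P (CoclassFamily.TMod p T (r + 1)))
    (hτ : CoclassFamily.LevelLE₂ p m (fun r => (τ r).toFun))
    (X Y : CoclassFamily.Triple m τ) :
    (∀ r s : Set.Ici r₀, X.conjIsos Y r = X.conjIsos Y s) ∧
    ((∃ r : Set.Ici r₀, X.AreConj Y r) ↔ ∀ r : Set.Ici r₀, X.AreConj Y r) ∧
    (∀ r s : Set.Ici r₀, X.quillenHoms Y r = X.quillenHoms Y s) := by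
  have hI : ∀ r s : Set.Ici r₀, X.conjIsos Y r = X.conjIsos Y s := by
    intro r s
    ext F
    rw [CoclassFamily.Triple.mem_conjIsos_iff, CoclassFamily.Triple.mem_conjIsos_iff]
    exact ⟨fun h => X.exists_induces_of_exists_induces hP hr₀ hτ Y h s,
      fun h => X.exists_induces_of_exists_induces hP hr₀ hτ Y h r⟩
  refine ⟨hI, ?_, ?_⟩
  · simp only [CoclassFamily.Triple.areConj_iff]
    exact ⟨fun ⟨r, h⟩ s => hI r s ▸ h, fun h => ⟨⟨r₀, le_refl r₀⟩, h _⟩⟩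
  · intro r s
    ext F
    rw [CoclassFamily.Triple.mem_quillenHoms_iff, CoclassFamily.Triple.mem_quillenHoms_iff]
    exact ⟨fun h => X.exists_induces_of_exists_induces hP hr₀ hτ Y h s,
      fun h => X.exists_induces_of_exists_induces hP hr₀ hτ Y h r⟩
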